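/- Let $L$ be a finite geometric lattice, that is, a finite lattice in which every element is a join of points (elements covering $0$; the empty join is $0$), and which is semimodular: whenever $a$ covers $a\wedge b$, the join $a\vee b$ covers $b$. Let the rank (height) of an element $x$ be the maximum length of a chain ending at $x$, let $d$ be the rank of $1$ (the rank of $L$), and let $W_k(L)$ be the number of elements of $L$ of rank $k$. Then \[ W_1(L)\le W_i(L)\qquad\text{for all integers } i \text{ with } 1\le i\le d-1, \] and if $W_1(L)=W_i(L)$ for some integer $i$ with $2\le i\le d-1$, then $i=d-1$. -/

import Mathlib

/-- A geometric lattice (with `0 = ⊥` and `1 = ⊤`): a semimodular point lattice, that is, if `a`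
covers `a ⊓ b` then `a ⊔ b` covers `b`, and every element is the join of a set of points
(the element `⊥` being the join of the empty set). -/
class IsGeometricLattice (L : Type*) [Lattice L] [BoundedOrder L] : Prop
    extends IsUpperModularLattice L, IsAtomistic L

/-- `levelNumber L k` is `W_k(L)`, the number of elements of height (rank) `k`, the height of `x`
being the maximum length of a chain ending at `x`. -/
noncomputable def levelNumber (L : Type*) [Lattice L] (k : ℕ) : ℕ :=
  {x : L | Order.height x = (k : ℕ∞)}.ncard

/-! Count non-incident pairs of a point `p` and an element `x` of rank `k + 1`, as in Conway's proof
of the de Bruijn–Erdős theorem. If `p ≰ x`, then `q ↦ q ⊔ p` embeds the points below `x` into the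
lines through `p`, and by induction in the upper interval of `p` there are at most as many such
lines as elements of rank `k + 1` above `p`. So `x` contains at most as many points as there are
elements of its rank through `p`, and this forces at most as many points as elements of rank
`k + 1`. If `p ⊔ x ≠ ⊤`, some line through `p` is not below `p ⊔ x`, which makes the inequality
strict.
-/

open Order

section DoubleCounting

variable {α β : Type*}

section Finset

open Finset

theorem sum_sum_one_div_card_mul_card_le_one (t : Finset β) (f : β → Finset α) :
    ∑ b ∈ t, ∑ _a ∈ f b, 1 / (#t * #(f b) : ℚ) ≤ 1 := calc
  ∑ b ∈ t, ∑ _a ∈ f b, 1 / (#t * #(f b) : ℚ)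
    = ∑ b ∈ t, (#(f b) / #(f b) : ℚ) * (1 / #t) := sum_congr rfl fun b _ => by
      rw [sum_const, nsmul_eq_mul]
      ring
  _ ≤ ∑ _b ∈ t, (1 / #t : ℚ) :=
    sum_le_sum fun b _ => mul_le_of_le_one_left (by positivity) (div_self_le_one _)
  _ = (#t / #t : ℚ) := by rw [sum_const, nsmul_eq_mul, mul_one_div]
  _ ≤ 1 := div_self_le_one _

theorem sum_sum_one_div_card_mul_card_eq_one {t : Finset β} {f : β → Finset α} (ht : t.Nonempty)
    (hf : ∀ b ∈ t, (f b).Nonempty) : ∑ b ∈ t, ∑ _a ∈ f b, 1 / (#t * #(f b) : ℚ) = 1 := by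
  have hinner (b) (hb : b ∈ t) : ∑ _a ∈ f b, 1 / (#t * #(f b) : ℚ) = 1 / #t := by
    have := (hf b hb).card_ne_zero
    rw [sum_const, nsmul_eq_mul]
    field_simp
  have := ht.card_ne_zero
  rw [sum_congr rfl hinner, sum_const, nsmul_eq_mul]
  field_simp

theorem exists_rel_card_mul_card_bipartiteBelow_le {s : Finset α} {t : Finset β}
    (r : α → β → Prop) [∀ a b, Decidable (r a b)] (ht : t.Nonempty)
    (hr : ∀ b ∈ t, ∃ a ∈ s, r a b) :
    ∃ a ∈ s, ∃ b ∈ t, r a b ∧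
      #t * #(s.bipartiteBelow r b) ≤ #s * #(t.bipartiteAbove r a) := by
  by_contra! hlt
  have hbelow (b) (hb : b ∈ t) : (s.bipartiteBelow r b).Nonempty := by
    simpa only [Finset.Nonempty, mem_bipartiteBelow] using hr b hb
  have hweight (b) (hb : b ∈ t) (a) (ha : a ∈ s.bipartiteBelow r b) :
      1 / (#t * #(s.bipartiteBelow r b) : ℚ) < 1 / (#s * #(t.bipartiteAbove r a)) := by
    obtain ⟨has, hab⟩ := (mem_bipartiteBelow r).1 ha
    have hs : 0 < #s := card_pos.2 ⟨a, has⟩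
    have habove : 0 < #(t.bipartiteAbove r a) :=
      card_pos.2 ⟨b, (mem_bipartiteAbove r).2 ⟨hb, hab⟩⟩
    exact one_div_lt_one_div_of_lt (by positivity) (by exact_mod_cast hlt a has b hb hab)
  have hone : (1 : ℚ) < 1 := calc
    (1 : ℚ) = ∑ b ∈ t, ∑ _a ∈ s.bipartiteBelow r b, 1 / (#t * #(s.bipartiteBelow r b) : ℚ) :=
      (sum_sum_one_div_card_mul_card_eq_one ht hbelow).symm
    _ < ∑ b ∈ t, ∑ a ∈ s.bipartiteBelow r b, 1 / (#s * #(t.bipartiteAbove r a) : ℚ) :=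
      sum_lt_sum_of_nonempty ht fun b hb => sum_lt_sum_of_nonempty (hbelow b hb) (hweight b hb)
    _ = ∑ a ∈ s, ∑ _b ∈ t.bipartiteAbove r a, 1 / (#s * #(t.bipartiteAbove r a) : ℚ) :=
      (sum_sum_bipartiteAbove_eq_sum_sum_bipartiteBelow r _).symm
    _ ≤ 1 := sum_sum_one_div_card_mul_card_le_one s _
  exact hone.false

end Finset

variable {P : Set α} {B : Set β} (I : α → β → Prop)

open scoped Finset in
theorem exists_not_rel_ncard_mul_ncard_le (hPfin : P.Finite) (hBfin : B.Finite)
    (hBne : B.Nonempty) (hB : ∀ x ∈ B, ∃ p ∈ P, ¬ I p x) :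
    ∃ p ∈ P, ∃ x ∈ B, ¬ I p x ∧
      P.ncard * {y ∈ B | I p y}.ncard ≤ B.ncard * {q ∈ P | I q x}.ncard := by
  classical
  lift P to Finset α using hPfin
  lift B to Finset β using hBfin
  obtain ⟨p, hp, x, hx, hpx, hle⟩ :=
    exists_rel_card_mul_card_bipartiteBelow_le (fun p x => ¬ I p x) hBne hB
  refine ⟨p, hp, x, hx, hpx, ?_⟩
  simp only [Finset.mem_coe, ← Finset.coe_filter, Set.ncard_coe_finset]
  have hpoints : #B * #{q ∈ P | I q x} + #B * #{q ∈ P | ¬ I q x} = #B * #P := by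
    rw [← mul_add, P.card_filter_add_card_filter_not]
  have hblocks : #P * #{y ∈ B | I p y} + #P * #{y ∈ B | ¬ I p y} = #P * #B := by
    rw [← mul_add, B.card_filter_add_card_filter_not]
  simp only [Finset.bipartiteBelow, Finset.bipartiteAbove] at hle
  linarith

theorem ncard_le_ncard_of_forall_not_rel (hPfin : P.Finite) (hBfin : B.Finite)
    (hB : ∀ x ∈ B, ∃ p ∈ P, ¬ I p x) (hP : ∀ p ∈ P, ∃ x ∈ B, I p x)
    (hI : ∀ p ∈ P, ∀ x ∈ B, ¬ I p x → {q ∈ P | I q x}.ncard ≤ {y ∈ B | I p y}.ncard) :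
    P.ncard ≤ B.ncard := by
  obtain rfl | ⟨p₀, hp₀⟩ := P.eq_empty_or_nonempty
  · simp
  have hBne : B.Nonempty := (hP p₀ hp₀).imp fun _ => And.left
  obtain ⟨p, hp, x, hx, hpx, hle⟩ := exists_not_rel_ncard_mul_ncard_le I hPfin hBfin hBne hB
  have hpos : 0 < {y ∈ B | I p y}.ncard := (Set.ncard_pos (hBfin.sep _)).2 (hP p hp)
  exact Nat.le_of_mul_le_mul_right (hle.trans (Nat.mul_le_mul_left _ (hI p hp x hx hpx))) hpos

theorem ncard_lt_ncard_of_forall_not_rel (hPfin : P.Finite) (hBfin : B.Finite)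
    (hBne : B.Nonempty) (hB : ∀ x ∈ B, ∃ p ∈ P, ¬ I p x)
    (hI : ∀ p ∈ P, ∀ x ∈ B, ¬ I p x → {q ∈ P | I q x}.ncard < {y ∈ B | I p y}.ncard) :
    P.ncard < B.ncard := by
  obtain ⟨p, hp, x, hx, hpx, hle⟩ := exists_not_rel_ncard_mul_ncard_le I hPfin hBfin hBne hB
  have hBpos : 0 < B.ncard := (Set.ncard_pos hBfin).2 hBne
  exact lt_of_mul_lt_mul_right
    (hle.trans_lt (Nat.mul_lt_mul_of_pos_left (hI p hp x hx hpx) hBpos)) (Nat.zero_le _)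

end DoubleCounting

section Graded

variable {L : Type*} [Lattice L] [IsWeakUpperModularLattice L]

theorem coheight_eq_add_one_of_covBy [IsStronglyAtomic L] [WellFoundedGT L] {x y : L}
    (hxy : x ⋖ y) : coheight x = coheight y + 1 := by
  induction x using WellFoundedGT.induction generalizing y with
  | ind x ih =>
    refine le_antisymm ?_ (coheight_add_one_le hxy.lt)
    rw [coheight_eq_iSup_gt_coheight]
    refine iSup₂_le fun u hu => ?_
    obtain ⟨z, hxz, hzu⟩ := exists_covBy_le_of_lt hu
    suffices hzy : coheight z = coheight y by
      grw [← hzy, hzu]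
    obtain rfl | hne := eq_or_ne y z
    · rfl
    have hinf : y ⊓ z = x := hxy.wcovBy.inf_eq hxz.wcovBy hne
    rw [ih z hxz.lt (covBy_sup_of_inf_covBy_of_inf_covBy_right (hinf ▸ hxy) (hinf ▸ hxz)),
      ih y hxy.lt (covBy_sup_of_inf_covBy_of_inf_covBy_left (hinf ▸ hxy) (hinf ▸ hxz))]

variable [BoundedOrder L] [WellFoundedLT L] [WellFoundedGT L]

theorem coheight_ne_top (x : L) : coheight x ≠ ⊤ := by
  induction x using WellFoundedGT.induction with
  | ind x ih =>
    obtain rfl | hx := eq_or_ne x ⊤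
    · simp
    obtain ⟨y, hxy, -⟩ := exists_covBy_le_of_lt hx.lt_top
    rw [coheight_eq_add_one_of_covBy hxy]
    simpa using ih y hxy.lt

theorem height_add_coheight (x : L) : height x + coheight x = coheight (⊥ : L) := by
  refine le_antisymm ?_ ?_
  · rw [← WithBot.coe_le_coe, coheight_bot_eq_krullDim,
      krullDim_eq_iSup_height_add_coheight_of_nonempty, WithBot.coe_le_coe]
    exact le_iSup (fun z : L => height z + coheight z) x
  induction x using WellFoundedLT.induction with
  | ind x ih =>
    obtain rfl | hx := eq_or_ne x ⊥
    · simp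
    obtain ⟨y, -, hyx⟩ := exists_le_covBy_of_lt hx.bot_lt
    calc coheight (⊥ : L) ≤ height y + coheight y := ih y hyx.lt
      _ = (height y + 1) + coheight x := by
        rw [coheight_eq_add_one_of_covBy hyx, add_assoc, add_comm 1]
      _ ≤ height x + coheight x := by grw [height_add_one_le hyx.lt]

theorem height_eq_add_one_of_covBy {x y : L} (hxy : x ⋖ y) : height y = height x + 1 := by
  have h := (height_add_coheight y).trans (height_add_coheight x).symm
  rw [coheight_eq_add_one_of_covBy hxy, add_comm (coheight y), ← add_assoc] at h
  exact ENat.add_left_injective_of_ne_top (coheight_ne_top y) h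

theorem height_ne_top (x : L) : height x ≠ ⊤ := by
  have h := coheight_ne_top (⊥ : L)
  rw [← height_add_coheight x] at h
  exact (WithTop.add_ne_top.1 h).1

theorem height_add_natCast_of_covBy {x y : L} (hxy : x ⋖ y) (k : ℕ) :
    height y + k = height x + (k + 1 : ℕ) := by
  rw [height_eq_add_one_of_covBy hxy, add_assoc, add_comm 1, ← Nat.cast_add_one]

theorem height_add_natCast_lt (x : L) {m n : ℕ} (hmn : m < n) : height x + m < height x + n :=
  (ENat.add_lt_add_iff_left (height_ne_top x)).2 (Nat.cast_lt.2 hmn)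

end Graded

section UpperModular

variable {L : Type*} [Lattice L] [IsUpperModularLattice L] {a p x : L}

theorem covBy_sup_of_covBy_of_not_le (hp : a ⋖ p) (hax : a ≤ x) (hpx : ¬ p ≤ x) :
    x ⋖ p ⊔ x := by
  refine covBy_sup_of_inf_covBy_left ?_
  rwa [(hp.eq_or_eq (le_inf hp.le hax) inf_le_left).resolve_right (inf_eq_left.not.2 hpx)]

theorem exists_covBy_not_le [BoundedOrder L] (htop : IsLUB {p : L | IsAtom p} ⊤) (hax : a ≤ x)
    (hx : x ≠ ⊤) : ∃ q, a ⋖ q ∧ ¬ q ≤ x := by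
  obtain ⟨p, hp, hpx⟩ : ∃ p, IsAtom p ∧ ¬ p ≤ x := by
    by_contra! h
    exact hx (top_le_iff.1 (htop.2 h))
  exact ⟨p ⊔ a, covBy_sup_of_covBy_of_not_le hp.bot_covBy bot_le fun h => hpx (h.trans hax),
    fun h => hpx (le_sup_left.trans h)⟩

theorem ncard_covBy_le_ncard_covBy_sup [Finite L] (hp : a ⋖ p) (hpx : ¬ p ≤ x) :
    {q | a ⋖ q ∧ q ≤ x}.ncard ≤ {l | p ⋖ l ∧ l ≤ p ⊔ x}.ncard := by
  refine Set.ncard_le_ncard_of_injOn (· ⊔ p) ?_ ?_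
  · rintro q ⟨hq, hqx⟩
    refine ⟨covBy_sup_of_covBy_of_not_le hq hp.le fun hqp => hpx ?_,
      sup_le (hqx.trans le_sup_right) le_sup_left⟩
    rwa [← (hp.eq_or_eq hq.le hqp).resolve_left hq.ne']
  · have hrecover : Set.LeftInvOn (· ⊓ x) (· ⊔ p) {q | a ⋖ q ∧ q ≤ x} := by
      rintro q ⟨hq, hqx⟩
      have hcov : q ⋖ p ⊔ q := covBy_sup_of_covBy_of_not_le hp hq.le fun h => hpx (h.trans hqx)
      rw [sup_comm] at hcov
      exact (hcov.eq_or_eq (le_inf le_sup_left hqx) inf_le_left).resolve_right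
        fun h => hpx (le_sup_right.trans (inf_eq_left.1 h))
    exact hrecover.injOn

end UpperModular

/-- The elements of rank `k` in the upper interval of `a`, that is, the elements above `a` whose
height exceeds that of `a` by `k`. -/
def upperLevel {L : Type*} [Preorder L] (a : L) (k : ℕ) : Set L :=
  {x | a ≤ x ∧ height x = height a + k}

theorem levelNumber_eq_ncard_upperLevel_bot (L : Type*) [Lattice L] [OrderBot L] (k : ℕ) :
    levelNumber L k = (upperLevel (⊥ : L) k).ncard := by
  simp [levelNumber, upperLevel]

section UpperLevel

variable {L : Type*} [Lattice L] [BoundedOrder L]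

section WellFounded

variable [IsWeakUpperModularLattice L] [WellFoundedLT L] [WellFoundedGT L] {a p : L} {k : ℕ}

theorem upperLevel_one : upperLevel a 1 = {p | a ⋖ p} := by
  ext p
  refine ⟨fun ⟨hap, hp⟩ => ?_, fun hp => ⟨hp.le, by simp [height_eq_add_one_of_covBy hp]⟩⟩
  have hlt : a < p := hap.lt_of_ne fun h => by
    subst h
    exact ((ENat.lt_add_one_iff (height_ne_top a)).2 le_rfl).ne (by simpa using hp)
  obtain ⟨c, hac, hcp⟩ := exists_covBy_le_of_lt hlt
  obtain rfl | hcp := hcp.eq_or_lt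
  · exact hac
  · have := height_strictMono hcp (height_ne_top c).lt_top
    rw [hp, height_eq_add_one_of_covBy hac] at this
    exact absurd this (by simp)

theorem sep_upperLevel_add_one (hp : a ⋖ p) :
    {x ∈ upperLevel a (k + 1) | p ≤ x} = upperLevel p k := by
  ext x
  simp only [upperLevel, Set.mem_ofPred_eq, height_add_natCast_of_covBy hp]
  exact ⟨fun h => ⟨h.2, h.1.2⟩, fun h => ⟨⟨hp.le.trans h.1, h.2⟩, h.1⟩⟩

theorem upperLevel_nonempty (hk : height a + k ≤ height (⊤ : L)) : (upperLevel a k).Nonempty := by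
  induction k with
  | zero => exact ⟨a, le_rfl, by simp⟩
  | succ k ih =>
    have hlt : height a + k < height (⊤ : L) :=
      (height_add_natCast_lt a k.lt_add_one).trans_le hk
    obtain ⟨x, hax, hx⟩ := ih hlt.le
    obtain ⟨y, hxy, -⟩ := exists_covBy_le_of_lt (lt_top_iff_ne_top.2 fun h : x = ⊤ =>
      (hx.trans_lt hlt).ne (by rw [h]))
    exact ⟨y, hax.trans hxy.le, by
      rw [height_eq_add_one_of_covBy hxy, hx, Nat.cast_add, Nat.cast_one, add_assoc]⟩

end WellFounded

theorem exists_covBy_not_le_of_mem_upperLevel [IsUpperModularLattice L] {a x : L} {k : ℕ}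
    (htop : IsLUB {p : L | IsAtom p} ⊤) (hk : height a + k < height (⊤ : L))
    (hx : x ∈ upperLevel a k) : ∃ p, a ⋖ p ∧ ¬ p ≤ x :=
  exists_covBy_not_le htop hx.1 fun h => by simp [← hx.2, h] at hk

variable [IsUpperModularLattice L] [Finite L] {k : ℕ}

theorem ncard_covBy_le_ncard_upperLevel (htop : IsLUB {p : L | IsAtom p} ⊤) (hk : 1 ≤ k) (a : L)
    (hak : height a + k < height (⊤ : L)) : {p | a ⋖ p}.ncard ≤ (upperLevel a k).ncard := by
  induction k, hk using Nat.le_induction generalizing a with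
  | base => rw [upperLevel_one]
  | succ k _ ih =>
    have hpk {p : L} (hp : a ⋖ p) : height p + k < height (⊤ : L) := by
      rwa [height_add_natCast_of_covBy hp]
    refine ncard_le_ncard_of_forall_not_rel (· ≤ ·) (Set.toFinite _) (Set.toFinite _)
      (fun x => exists_covBy_not_le_of_mem_upperLevel htop hak)
      (fun p hp => ?_) (fun p hp x _ hpx => ?_)
    · obtain ⟨x, hx⟩ := upperLevel_nonempty (hpk hp).le
      rw [← sep_upperLevel_add_one hp] at hx
      exact ⟨x, hx⟩
    · rw [sep_upperLevel_add_one hp]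
      calc {q ∈ {q | a ⋖ q} | q ≤ x}.ncard
          ≤ {l | p ⋖ l ∧ l ≤ p ⊔ x}.ncard := ncard_covBy_le_ncard_covBy_sup hp hpx
        _ ≤ {l | p ⋖ l}.ncard := Set.ncard_le_ncard (Set.sep_subset _ _)
        _ ≤ (upperLevel p k).ncard := ih p (hpk hp)

theorem ncard_covBy_lt_ncard_upperLevel (htop : IsLUB {p : L | IsAtom p} ⊤) (hk : 1 ≤ k) {a : L}
    (hak : height a + (k + 2 : ℕ) < height (⊤ : L)) :
    {p | a ⋖ p}.ncard < (upperLevel a (k + 1)).ncard := by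
  have hak' : height a + (k + 1 : ℕ) < height (⊤ : L) :=
    (height_add_natCast_lt a (k + 1).lt_add_one).trans hak
  refine ncard_lt_ncard_of_forall_not_rel (· ≤ ·) (Set.toFinite _) (Set.toFinite _)
    (upperLevel_nonempty hak'.le) (fun x => exists_covBy_not_le_of_mem_upperLevel htop hak')
    (fun p hp x hx hpx => ?_)
  have hpk : height p + k < height (⊤ : L) := by
    rwa [height_add_natCast_of_covBy hp]
  have hjoin : p ⊔ x ≠ ⊤ := fun h => by
    have := height_eq_add_one_of_covBy (covBy_sup_of_covBy_of_not_le hp hx.1 hpx)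
    rw [h, hx.2, add_assoc, ← Nat.cast_add_one] at this
    exact hak.ne' this
  obtain ⟨l, hpl, hl⟩ := exists_covBy_not_le htop (le_sup_left : p ≤ p ⊔ x) hjoin
  rw [sep_upperLevel_add_one hp]
  calc {q ∈ {q | a ⋖ q} | q ≤ x}.ncard
      ≤ {l | p ⋖ l ∧ l ≤ p ⊔ x}.ncard := ncard_covBy_le_ncard_covBy_sup hp hpx
    _ < {l | p ⋖ l}.ncard := Set.ncard_lt_ncard ⟨Set.sep_subset _ _, fun h => hl (h hpl).2⟩
    _ ≤ (upperLevel p k).ncard := ncard_covBy_le_ncard_upperLevel htop hk p hpk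

end UpperLevel

theorem mainTheorem11_general {L : Type*} [Lattice L] [BoundedOrder L] [Finite L]
    [IsUpperModularLattice L] (htop : IsLUB {p : L | IsAtom p} ⊤)
    (d : ℕ) (hd : height (⊤ : L) = (d : ℕ∞)) :
    (∀ i : ℕ, 1 ≤ i → i < d → levelNumber L 1 ≤ levelNumber L i) ∧
    (∀ i : ℕ, 2 ≤ i → i < d → levelNumber L 1 = levelNumber L i → i = d - 1) := by
  have hlt {k : ℕ} (hk : k < d) : height (⊥ : L) + k < height (⊤ : L) := by
    simpa [hd] using hk
  simp only [levelNumber_eq_ncard_upperLevel_bot, upperLevel_one]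
  refine ⟨fun i hi hid => ncard_covBy_le_ncard_upperLevel htop hi ⊥ (hlt hid),
    fun i hi hid heq => ?_⟩
  obtain ⟨k, rfl⟩ := Nat.exists_eq_add_of_le' (one_le_two.trans hi)
  by_contra hne
  exact (ncard_covBy_lt_ncard_upperLevel htop (by omega) (hlt (by omega))).ne heq

theorem mainTheorem11 {L : Type*} [Lattice L] [BoundedOrder L] [Finite L] [IsGeometricLattice L]
    (d : ℕ) (hd : Order.height (⊤ : L) = (d : ℕ∞)) :
    (∀ i : ℕ, 1 ≤ i → i < d → levelNumber L 1 ≤ levelNumber L i) ∧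
    (∀ i : ℕ, 2 ≤ i → i < d → levelNumber L 1 = levelNumber L i → i = d - 1) :=
  mainTheorem11_general isLUB_atoms_top d hd
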